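/- Let $d\in\mathbb{N}$, and let $\mathcal{T}^1$ be the set of trace class operators on $L^2(\mathbb{R}^d)$, i.e. of the bounded operators whose singular values are summable. For $z=(x,\omega)\in\mathbb{R}^{2d}$ let $\pi(z)$ be the unitary operator on $L^2(\mathbb{R}^d)$ given by $(\pi(z)\psi)(t)=e^{2\pi i\,\omega\cdot t}\psi(t-x)$, and let $\alpha_z(A)=\pi(z)A\pi(z)^*$ for a bounded operator $A$. For $f\in L^1(\mathbb{R}^{2d})$ and $A\in\mathcal{T}^1$ let $f\ast A=\int_{\mathbb{R}^{2d}}f(y)\,\alpha_y(A)\,dy$, the integral being taken in the weak sense: $\langle\eta,(f\ast A)\psi\rangle=\int_{\mathbb{R}^{2d}}f(y)\,\langle\eta,\alpha_y(A)\psi\rangle\,dy$ for all $\psi,\eta\in L^2(\mathbb{R}^d)$, with $\langle\cdot,\cdot\rangle$ linear in the second argument. For $\sigma,S\in\mathcal{T}^1$, a function $f\in L^1(\mathbb{R}^{2d})$ is called a generalized Glauber–Sudarshan representation of $S$ with respect to $\sigma$, written $f=S_{-\sigma}$, if $S=f\ast\sigma^*$, where $\sigma^*$ is the adjoint of $\sigma$.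 **Proposition 3.4** (existence of a Glauber–Sudarshan representation for some $\sigma$). For every $S\in\mathcal{T}^1$ there exists some $\sigma\in\mathcal{T}^1$ such that $S$ has a generalized Glauber–Sudarshan representation $S_{-\sigma}\in L^1(\mathbb{R}^{2d})$ with respect to $\sigma$. -/

import Mathlib

open MeasureTheory

noncomputable section

namespace PhaseSpace

/-- Position (or momentum) space, the Euclidean space of dimension `d`. -/
abbrev Pos (d : ℕ) : Type := EuclideanSpace ℝ (Fin d)

/-- Phase space of dimension `2 d`; its points are written `z = (x, ω)`, and its `volume` is
Lebesgue measure `dx dω`. -/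
abbrev Phase (d : ℕ) : Type := Pos d × Pos d

/-- The Hilbert space of (classes of) square integrable complex functions on `Pos d`. -/
abbrev L2 (d : ℕ) : Type := Lp ℂ 2 (volume : Measure (Pos d))

/-- The singular values of `A`, counted with multiplicity, are summable: `A` has a singular value
decomposition `A ψ = ∑ s i ⟨ψ, v i⟩ u i` with orthonormal families `u`, `v` and positive
`s i` such that `∑ s i < ∞`. The index set is a set of natural numbers, so that operators of
finite rank are covered too. -/
def IsTraceClass {H : Type*} [NormedAddCommGroup H] [InnerProductSpace ℂ H]
    (A : H →L[ℂ] H) : Prop :=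
  ∃ (J : Set ℕ) (s : J → ℝ) (u v : J → H),
    Orthonormal ℂ u ∧ Orthonormal ℂ v ∧ (∀ i, 0 < s i) ∧ Summable s ∧
      ∀ ψ : H, HasSum (fun i => ((s i : ℂ) * inner ℂ (v i) ψ) • u i) (A ψ)

/-- Translation `(T_x ψ)(t) = ψ(t - x)`. -/
def translation {d : ℕ} (x : Pos d) : L2 d →L[ℂ] L2 d :=
  (Lp.compMeasurePreservingₗᵢ ℂ (fun t : Pos d => t - x)
    (measurePreserving_sub_right volume x)).toContinuousLinearMap

/-- The function `t ↦ e^{2 π i ω · t}`. -/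
def character {d : ℕ} (ω t : Pos d) : ℂ :=
  Complex.exp (2 * (Real.pi : ℂ) * Complex.I * ((inner ℝ ω t : ℝ) : ℂ))

theorem norm_character {d : ℕ} (ω t : Pos d) : ‖character ω t‖ = 1 := by
  rw [character, Complex.norm_exp]
  simp

theorem continuous_character {d : ℕ} (ω : Pos d) : Continuous (character ω) := by
  unfold character
  fun_prop

theorem memLp_character_mul {d : ℕ} (ω : Pos d) (ψ : L2 d) :
    MemLp (fun t => character ω t * ψ t) 2 volume :=
  (Lp.memLp ψ).of_le
    ((continuous_character ω).aestronglyMeasurable.mul (Lp.aestronglyMeasurable ψ))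
    (Filter.Eventually.of_forall fun t => by rw [norm_mul, norm_character, one_mul])

/-- Modulation `(M_ω ψ)(t) = e^{2 π i ω · t} ψ(t)`. -/
def modulation {d : ℕ} (ω : Pos d) : L2 d →L[ℂ] L2 d :=
  LinearMap.mkContinuous
    { toFun := fun ψ => (memLp_character_mul ω ψ).toLp (fun t => character ω t * ψ t)
      map_add' := fun ψ φ => by
        rw [← MemLp.toLp_add, MemLp.toLp_eq_toLp_iff]
        filter_upwards [Lp.coeFn_add ψ φ] with t ht
        simp only [ht, Pi.add_apply, mul_add]
      map_smul' := fun c ψ => by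
        rw [RingHom.id_apply, ← MemLp.toLp_const_smul, MemLp.toLp_eq_toLp_iff]
        filter_upwards [Lp.coeFn_smul c ψ] with t ht
        simp only [ht, Pi.smul_apply, smul_eq_mul]
        ring }
    1 (fun ψ => by
      rw [one_mul]
      refine Lp.norm_le_norm_of_ae_le ?_
      filter_upwards [(memLp_character_mul ω ψ).coeFn_toLp] with t ht
      simp only [LinearMap.coe_mk, AddHom.coe_mk, ht, norm_mul, norm_character, one_mul, le_refl])

/-- The time-frequency shift `π(z) = M_ω T_x` for `z = (x, ω)`. -/
def timeFreqShift {d : ℕ} (z : Phase d) : L2 d →L[ℂ] L2 d :=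
  modulation z.2 ∘L translation z.1

/-- The shift of operators `α_z(A) = π(z) A π(z)*`. -/
def opShift {d : ℕ} (z : Phase d) (A : L2 d →L[ℂ] L2 d) : L2 d →L[ℂ] L2 d :=
  timeFreqShift z ∘L A ∘L ContinuousLinearMap.adjoint (timeFreqShift z)

/-- `B` is the weak integral `∫ F y dμ(y)` of the operator-valued function `F`: for all `η, ψ` the
function `⟨η, F y ψ⟩` is integrable and its integral is `⟨η, B ψ⟩`. At most one `B` has this
property. -/
def IsWeakIntegral {X H : Type*} [MeasurableSpace X] [NormedAddCommGroup H]
    [InnerProductSpace ℂ H] (μ : Measure X) (F : X → H →L[ℂ] H) (B : H →L[ℂ] H) : Prop :=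
  ∀ η ψ : H, Integrable (fun y => inner ℂ η (F y ψ)) μ ∧
    inner ℂ η (B ψ) = ∫ y, inner ℂ η (F y ψ) ∂μ

/-- `B = f ∗ A`, the convolution `∫ f(y) α_y(A) dy` of a function with an operator, the integral
over phase space being taken in the weak sense. -/
def IsConvolution {d : ℕ} (f : Phase d → ℂ) (A B : L2 d →L[ℂ] L2 d) : Prop :=
  IsWeakIntegral volume (fun y => f y • opShift y A) B

/-- `f` is a generalized Glauber–Sudarshan representation of `S` with respect to `σ`:
`S = f ∗ σ*`. -/
def IsGlauberSudarshan {d : ℕ} (σ S : L2 d →L[ℂ] L2 d) (f : Phase d → ℂ) : Prop :=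
  IsConvolution f (ContinuousLinearMap.adjoint σ) S

end PhaseSpace

end

open scoped Topology ENNReal InnerProductSpace
open InnerProductSpace (rankOne)

/-! The claim is an instance of Cohen's factorization theorem. The time-frequency shifts form a
projective representation, and the phases cancel in `α_z`, so phase space acts on trace class
operators by contractions with continuous orbits. The convolution algebra `L¹` then acts by
integration and has approximate units (normalized indicators of small neighbourhoods of 0), so every
vector factors as `f ∗ y`.

Instead of the trace norm, the proof uses the dual norm of functionals on bounded operators, with
`A` represented by `B ↦ tr (A B)`. The factorization takes place in `regularFunctionals`, a closed
invariant subspace that contains these functionals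
(`IsProjectiveRep.exists_operatorOfFunctional_eq`). The factor `y` found there may a priori be any
element of that subspace, but its operator is compact and has bounded traces against finite rank
partial isometries; hence it is trace class (`isTraceClass_adjoint_operatorOfFunctional`), and its
adjoint serves as `σ`. -/

/-! ### Cohen's factorization theorem. -/

theorem Units.exists_eq_one_sub_of_norm_le_half {X : Type*} [NormedAddCommGroup X]
    [NormedSpace ℂ X] [CompleteSpace X] (t : X →L[ℂ] X) (ht : ‖t‖ ≤ 1 / 2) :
    ∃ E : (X →L[ℂ] X)ˣ, (E : X →L[ℂ] X) = 1 - t ∧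
      ∀ v, ‖(↑E⁻¹ : X →L[ℂ] X) v‖ ≤ 2 * ‖v‖ := by
  refine ⟨Units.oneSub t (by linarith), rfl, fun v => ?_⟩
  set E := Units.oneSub t (by linarith) with hE
  set z := (↑E⁻¹ : X →L[ℂ] X) v with hz
  have h1 : v = z - t z := by
    have : ((E : X →L[ℂ] X) * (↑E⁻¹ : X →L[ℂ] X)) v = v := by
      rw [Units.mul_inv]; rfl
    have h2 : (E : X →L[ℂ] X) = 1 - t := rfl
    rw [h2] at this
    exact this.symm
  have h2 : ‖z‖ ≤ ‖v‖ + ‖t z‖ := by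
    have : z = v + t z := by rw [h1]; abel
    calc ‖z‖ = ‖v + t z‖ := by rw [← this]
      _ ≤ _ := norm_add_le _ _
  have h3 : ‖t z‖ ≤ 1 / 2 * ‖z‖ := t.le_of_opNorm_le ht z
  linarith

/-- Cohen's factorization theorem for a bounded bilinear action `Φ` of a Banach space on a Banach
space that admits approximate units, the element `q` playing the role of the product `e * p`. -/
theorem exists_factorization_of_approximate_unit {X Λ : Type*}
    [NormedAddCommGroup X] [NormedSpace ℂ X] [CompleteSpace X]
    [NormedAddCommGroup Λ] [NormedSpace ℂ Λ] [CompleteSpace Λ]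
    (Φ : Λ →L[ℂ] X →L[ℂ] X) (hΦ : ∀ p, ‖Φ p‖ ≤ ‖p‖)
    (H : ∀ (x : X) (p : Λ) (ε : ℝ), 0 < ε → ∃ e q : Λ, ‖e‖ ≤ 1 ∧ Φ q = Φ e * Φ p ∧
      ‖Φ e x - x‖ ≤ ε ∧ ‖q - p‖ ≤ ε) (x : X) :
    ∃ (f : Λ) (y : X), Φ f y = x := by
  -- The approximants are `P_n = (3/4)^n + Φ p_n`, invertible, and `y_n = P_n⁻¹ x`. As `p_n → f` and
  -- `y_n → y`, the identity `P_n y_n = x` becomes `Φ f y = x`.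
  let Inv (n : ℕ) (s : Λ × (X →L[ℂ] X)ˣ) : Prop :=
    (s.2 : X →L[ℂ] X) = ((3 / 4 : ℂ) ^ n) • 1 + Φ s.1 ∧
      ∀ v, ‖(↑s.2⁻¹ : X →L[ℂ] X) v‖ ≤ 2 ^ n * ‖v‖
  have step : ∀ n (s : {s // Inv n s}), ∃ s' : {s // Inv (n + 1) s},
      ‖s'.1.1 - s.1.1‖ ≤ (3 / 4 : ℝ) ^ n ∧
      ‖(↑s'.1.2⁻¹ : X →L[ℂ] X) x - (↑s.1.2⁻¹ : X →L[ℂ] X) x‖ ≤ (1 / 2 : ℝ) ^ n := by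
    rintro n ⟨⟨p, P⟩, hP, hinv⟩
    simp only at hP hinv
    -- The error `(1/4)^n` has to beat the bound `2^n` on the inverse.
    obtain ⟨e, q, he, hq, hx, hqp⟩ := H x p ((1 / 4 : ℝ) ^ n) (by positivity)
    obtain ⟨E, hE, hEinv⟩ := Units.exists_eq_one_sub_of_norm_le_half ((1 / 4 : ℂ) • (1 - Φ e)) (by
      rw [norm_smul]
      have h1 : ‖(1 : X →L[ℂ] X)‖ ≤ 1 := ContinuousLinearMap.norm_id_le
      have h2 := norm_sub_le (1 : X →L[ℂ] X) (Φ e)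
      have h3 := hΦ e
      have : ‖(1 / 4 : ℂ)‖ = 1 / 4 := by norm_num
      rw [this]
      linarith)
    have hEx : ‖(↑E⁻¹ : X →L[ℂ] X) x - x‖ ≤ 1 / 2 * (1 / 4 : ℝ) ^ n := by
      have h1 : (↑E⁻¹ : X →L[ℂ] X) x - x = (↑E⁻¹ : X →L[ℂ] X) ((1 / 4 : ℂ) • (x - Φ e x)) := by
        have h2 : (↑E⁻¹ : X →L[ℂ] X) ((E : X →L[ℂ] X) x) = x := by
          have : ((↑E⁻¹ : X →L[ℂ] X) * (E : X →L[ℂ] X)) x = x := by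
            rw [Units.inv_mul]; rfl
          exact this
        have h3 : (1 / 4 : ℂ) • (x - Φ e x) = x - (E : X →L[ℂ] X) x := by
          rw [hE]
          simp
        rw [h3, map_sub, h2]
      rw [h1]
      refine (hEinv _).trans ?_
      rw [norm_smul, norm_sub_rev]
      have : ‖(1 / 4 : ℂ)‖ = 1 / 4 := by norm_num
      rw [this]
      linarith
    -- The product of `E = 3/4 + Φ e / 4` and `P = (3/4)^n + Φ p`, expanded, with `Φ e * Φ p`
    -- replaced by `Φ q`. With `E` on the left, `y` changes by `P⁻¹ (E⁻¹ x - x)`, so `e` need only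
    -- be an approximate unit at the fixed vector `x` and at `p`.
    refine ⟨⟨((3 / 4 : ℂ) • p + (1 / 4 : ℂ) • q + ((1 / 4 : ℂ) * (3 / 4) ^ n) • e, E * P), ?_, ?_⟩,
      ?_, ?_⟩
    · simp only [Units.val_mul, hP, hE, map_add, map_smul, hq]
      ext v
      simp
      module
    · intro v
      simp only [mul_inv_rev, Units.val_mul, mul_apply_eq_comp]
      refine (hinv _).trans ?_
      rw [pow_succ, mul_assoc]
      gcongr
      exact hEinv v
    · simp only
      have h1 : (3 / 4 : ℂ) • p + (1 / 4 : ℂ) • q + ((1 / 4 : ℂ) * (3 / 4) ^ n) • e - p =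
          (1 / 4 : ℂ) • (q - p) + ((1 / 4 : ℂ) * (3 / 4) ^ n) • e := by module
      rw [h1]
      refine (norm_add_le _ _).trans ?_
      rw [norm_smul, norm_smul, norm_mul, norm_pow]
      have : ‖(1 / 4 : ℂ)‖ = 1 / 4 := by norm_num
      have h2 : ‖(3 / 4 : ℂ)‖ = 3 / 4 := by norm_num
      rw [this, h2]
      have h3 : (1 / 4 : ℝ) ^ n ≤ (3 / 4 : ℝ) ^ n := by gcongr; norm_num
      have h4 : 0 ≤ (3 / 4 : ℝ) ^ n := by positivity
      nlinarith
    · simp only [mul_inv_rev, Units.val_mul, mul_apply_eq_comp]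
      rw [← map_sub]
      refine (hinv _).trans ?_
      calc (2 : ℝ) ^ n * ‖(↑E⁻¹ : X →L[ℂ] X) x - x‖ ≤ 2 ^ n * (1 / 2 * (1 / 4 : ℝ) ^ n) := by gcongr
        _ = 1 / 2 * (1 / 2 : ℝ) ^ n := by
          rw [mul_left_comm, ← mul_pow]; norm_num
        _ ≤ (1 / 2 : ℝ) ^ n := by
          have : 0 ≤ (1 / 2 : ℝ) ^ n := by positivity
          linarith
  choose next hp hy using step
  let s : ∀ n, {s // Inv n s} := fun n =>
    Nat.rec (motive := fun n => {s // Inv n s})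
      ⟨(0, 1), by simp, fun v => by simp⟩ (fun n s => next n s) n
  have hs : ∀ n, s (n + 1) = next n (s n) := fun n => rfl
  have hc1 : CauchySeq (fun n => (s n).1.1) := by
    refine cauchySeq_of_le_geometric (3 / 4 : ℝ) 1 (by norm_num) fun n => ?_
    rw [dist_comm, dist_eq_norm, hs, one_mul]
    exact hp n (s n)
  have hc2 : CauchySeq (fun n => (↑(s n).1.2⁻¹ : X →L[ℂ] X) x) := by
    refine cauchySeq_of_le_geometric (1 / 2 : ℝ) 1 (by norm_num) fun n => ?_
    rw [dist_comm, dist_eq_norm, hs, one_mul]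
    exact hy n (s n)
  obtain ⟨f, hf⟩ := cauchySeq_tendsto_of_complete hc1
  obtain ⟨y, hy'⟩ := cauchySeq_tendsto_of_complete hc2
  refine ⟨f, y, ?_⟩
  have hpow : Filter.Tendsto (fun n => (3 / 4 : ℂ) ^ n) Filter.atTop (𝓝 0) :=
    tendsto_pow_atTop_nhds_zero_of_norm_lt_one (by norm_num)
  have hΦf : Filter.Tendsto (fun n => Φ (s n).1.1) Filter.atTop (𝓝 (Φ f)) :=
    (Φ.continuous.tendsto f).comp hf
  have hlim : Filter.Tendsto (fun n => (3 / 4 : ℂ) ^ n • (↑(s n).1.2⁻¹ : X →L[ℂ] X) x +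
      Φ (s n).1.1 ((↑(s n).1.2⁻¹ : X →L[ℂ] X) x)) Filter.atTop (𝓝 ((0 : ℂ) • y + Φ f y)) :=
    (hpow.smul hy').add ((isBoundedBilinearMap_apply.continuous.tendsto (Φ f, y)).comp (hΦf.prodMk_nhds hy'))
  rw [zero_smul, zero_add] at hlim
  refine tendsto_nhds_unique hlim (tendsto_const_nhds.congr fun n => ?_)
  have h1 : (((s n).1.2 : X →L[ℂ] X) * (↑(s n).1.2⁻¹ : X →L[ℂ] X)) x = x := by
    rw [Units.mul_inv]; rfl
  rw [(s n).2.1] at h1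
  exact h1.symm

/-! ### Action of integrable functions on a contractive representation. -/

section ContractiveRep

variable {G X : Type*} [AddCommGroup G] [TopologicalSpace G]
  [NormedAddCommGroup X] [NormedSpace ℂ X]

/-- A strongly continuous representation of an additive group by contractions of a Banach space. -/
structure IsContractiveRep (U : G → X →L[ℂ] X) : Prop where
  map_add : ∀ z w x, U (z + w) x = U z (U w x)
  map_zero : ∀ x, U 0 x = x
  norm_le : ∀ z x, ‖U z x‖ ≤ ‖x‖
  continuous : ∀ x, Continuous fun z => U z x

variable [MeasurableSpace G] {μ : Measure G}  {U : G → X →L[ℂ] X}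

theorem IsContractiveRep.norm_integral_smul_le (hU : IsContractiveRep U) (g : Lp ℂ 1 μ) (x : X) :
    ‖∫ z, g z • U z x ∂μ‖ ≤ 1 * ‖g‖ * ‖x‖ := by
  rw [one_mul, L1.norm_eq_integral_norm, ← integral_mul_const]
  refine norm_integral_le_of_norm_le ((L1.integrable_coeFn g).norm.mul_const _)
    (Filter.Eventually.of_forall fun z => ?_)
  rw [norm_smul]
  gcongr
  exact hU.norm_le z x

variable [BorelSpace G] [SecondCountableTopology G]

theorem IsContractiveRep.integrable_smul (hU : IsContractiveRep U) {g : G → ℂ}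
    (hg : Integrable g μ) (x : X) : Integrable (fun z => g z • U z x) μ :=
  hg.smul_bdd ‖x‖ (hU.continuous x).stronglyMeasurable.aestronglyMeasurable
    (Filter.Eventually.of_forall fun z => hU.norm_le z x)

/-- The action `g, x ↦ ∫ g z • U z x` of integrable functions on the space of a representation. -/
noncomputable def IsContractiveRep.integrated (hU : IsContractiveRep U) (μ : Measure G) :
    Lp ℂ 1 μ →L[ℂ] X →L[ℂ] X :=
  LinearMap.mkContinuous₂
    (LinearMap.mk₂ ℂ (fun (g : Lp ℂ 1 μ) x => ∫ z, g z • U z x ∂μ)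
      (fun g h x => by
        rw [← integral_add (hU.integrable_smul (L1.integrable_coeFn g) x)
          (hU.integrable_smul (L1.integrable_coeFn h) x)]
        refine integral_congr_ae ?_
        filter_upwards [Lp.coeFn_add g h] with z hz
        rw [hz, Pi.add_apply, add_smul])
      (fun c g x => by
        rw [← integral_smul]
        refine integral_congr_ae ?_
        filter_upwards [Lp.coeFn_smul c g] with z hz
        rw [hz, Pi.smul_apply, smul_assoc])
      (fun g x y => by
        rw [← integral_add (hU.integrable_smul (L1.integrable_coeFn g) x)
          (hU.integrable_smul (L1.integrable_coeFn g) y)]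
        simp only [_root_.map_add, smul_add])
      (fun c g x => by
        rw [← integral_smul]
        simp only [map_smul, smul_comm c]))
    1 hU.norm_integral_smul_le

theorem IsContractiveRep.integrated_apply (hU : IsContractiveRep U) (g : Lp ℂ 1 μ) (x : X) :
    hU.integrated μ g x = ∫ z, g z • U z x ∂μ := rfl

theorem IsContractiveRep.norm_integrated_le (hU : IsContractiveRep U) (g : Lp ℂ 1 μ) :
    ‖hU.integrated μ g‖ ≤ ‖g‖ := by
  refine ContinuousLinearMap.opNorm_le_bound _ (norm_nonneg _) fun x => ?_
  rw [← one_mul ‖g‖]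
  exact hU.norm_integral_smul_le g x

/-- The normalized indicator acts as the average over `V`, and averages of points of a closed ball
stay in it by convexity. -/
theorem IsContractiveRep.norm_integrated_indicator_sub_le [CompleteSpace X]
    (hU : IsContractiveRep U) {V : Set G}
    (hV : MeasurableSet V) (hV0 : μ V ≠ 0) (hV1 : μ V ≠ ∞) {x : X} {ε : ℝ}
    (h : ∀ z ∈ V, ‖U z x - x‖ ≤ ε) :
    ‖hU.integrated μ (indicatorConstLp 1 hV hV1 (((μ.real V)⁻¹ : ℝ) : ℂ)) x - x‖ ≤ ε := by
  have h1 : hU.integrated μ (indicatorConstLp 1 hV hV1 (((μ.real V)⁻¹ : ℝ) : ℂ)) x =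
      ⨍ z in V, U z x ∂μ := by
    rw [hU.integrated_apply, setAverage_eq, ← integral_indicator hV, ← integral_smul]
    refine integral_congr_ae ?_
    filter_upwards [indicatorConstLp_coeFn (p := 1) (hs := hV) (hμs := hV1)
      (c := (((μ.real V)⁻¹ : ℝ) : ℂ))] with z hz
    rw [hz]
    by_cases hzV : z ∈ V
    · simp only [Set.indicator_of_mem hzV, Complex.coe_smul]
    · simp [hzV]
  rw [h1, ← dist_eq_norm]
  refine (convex_closedBall x ε).set_average_mem Metric.isClosed_closedBall hV0 hV1 ?_ ?_
  · refine (ae_restrict_iff' hV).2 (Filter.Eventually.of_forall fun z hz => ?_)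
    rw [Metric.mem_closedBall, dist_eq_norm]
    exact h z hz
  · refine Measure.integrableOn_of_bounded (M := ‖x‖) hV1
      (hU.continuous x).stronglyMeasurable.aestronglyMeasurable
      (Filter.Eventually.of_forall fun z => hU.norm_le z x)

end ContractiveRep

/-! ### Translations, convolution, and factorization for representations. -/

section Translation

variable {G : Type*} [NormedAddCommGroup G] [MeasurableSpace G] [BorelSpace G]
  (μ : Measure G) [μ.IsAddHaarMeasure]

/-- Translation of `p`-integrable functions. -/
noncomputable def translationLp (p : ℝ≥0∞) [Fact (1 ≤ p)] (z : G) : Lp ℂ p μ →L[ℂ] Lp ℂ p μ :=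
  (Lp.compMeasurePreservingₗᵢ ℂ (fun t : G => t - z)
    (measurePreserving_sub_right μ z)).toContinuousLinearMap

theorem coeFn_translationLp {p : ℝ≥0∞} [Fact (1 ≤ p)] (z : G) (g : Lp ℂ p μ) :
    translationLp μ p z g =ᵐ[μ] fun t => g (t - z) :=
  Lp.coeFn_compMeasurePreserving g (measurePreserving_sub_right μ z)

theorem norm_translationLp {p : ℝ≥0∞} [Fact (1 ≤ p)] (z : G) (g : Lp ℂ p μ) :
    ‖translationLp μ p z g‖ = ‖g‖ :=
  LinearIsometry.norm_map (Lp.compMeasurePreservingₗᵢ ℂ (fun t : G => t - z)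
    (measurePreserving_sub_right μ z)) g

/-- Needed for `p = 1` to form convolutions and approximate units, and for `p = 2` for the
continuity of the time-frequency shifts. -/
theorem isContractiveRep_translationLp [LocallyCompactSpace G]
    [μ.InnerRegularCompactLTTop] (p : ℝ≥0∞) [Fact (1 ≤ p)] (hp : p ≠ ∞) :
    IsContractiveRep (translationLp μ p) where
  map_add z w g := by
    refine Lp.ext ?_
    have h := (measurePreserving_sub_right μ z).quasiMeasurePreserving.ae
      (coeFn_translationLp μ w g)
    filter_upwards [coeFn_translationLp μ (z + w) g,
      coeFn_translationLp μ z (translationLp μ p w g), h] with t h1 h2 h3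
    rw [h1, h2, h3, sub_sub]
  map_zero g := by
    refine Lp.ext ?_
    filter_upwards [coeFn_translationLp μ 0 g] with t h1
    rw [h1, sub_zero]
  norm_le z g := (norm_translationLp μ z g).le
  continuous g := by
    have hc : Continuous fun z : G => (⟨fun t => t - z, by fun_prop⟩ : C(G, G)) :=
      ContinuousMap.continuous_of_continuous_uncurry _ (by
        show Continuous fun q : G × G => q.2 - q.1
        fun_prop)
    exact (continuous_const (y := g)).compMeasurePreservingLp hc
      (measurePreserving_sub_right μ) hp

variable [SecondCountableTopology G] {μ} {X : Type*} [NormedAddCommGroup X] [NormedSpace ℂ X] [CompleteSpace X]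
  {U : G → X →L[ℂ] X}

theorem IsContractiveRep.integrated_translationLp (hU : IsContractiveRep U) (z : G)
    (g : Lp ℂ 1 μ) (x : X) :
    hU.integrated μ (translationLp μ 1 z g) x = U z (hU.integrated μ g x) := by
  rw [hU.integrated_apply, hU.integrated_apply,
    ← (U z).integral_comp_comm (hU.integrable_smul (L1.integrable_coeFn g) x)]
  rw [← integral_sub_right_eq_self (fun w => U z (g w • U w x)) z]
  refine integral_congr_ae ?_
  filter_upwards [coeFn_translationLp μ z g] with t ht
  rw [ht, map_smul, ← hU.map_add, add_sub_cancel]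

/-- The convolution `e ∗ g` is taken as an integral of translates of `g` in `L¹`. The bounded map `g
↦ ∫ g z • U z x` passes under this integral and turns translation by `z` into `U z`, so no
interchange of integrals is needed. -/
theorem IsContractiveRep.integrated_integrated (hU : IsContractiveRep U)
    (hτ : IsContractiveRep (translationLp μ 1)) (e g : Lp ℂ 1 μ) :
    hU.integrated μ (hτ.integrated μ e g) = hU.integrated μ e * hU.integrated μ g := by
  ext x
  rw [mul_apply_eq_comp, hU.integrated_apply e]
  have h := ((hU.integrated μ).flip x).integral_comp_comm
    (hτ.integrable_smul (L1.integrable_coeFn e) g)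
  simp only [ContinuousLinearMap.flip_apply] at h
  rw [hτ.integrated_apply]
  refine h.symm.trans ?_
  refine integral_congr_ae (Filter.Eventually.of_forall fun z => ?_)
  simp only [map_smul, smul_apply, hU.integrated_translationLp]

/-- Every vector of a strongly continuous contractive representation of a locally compact
group is of the form `∫ f z • U z y` with an integrable function `f`. -/
theorem IsContractiveRep.exists_integrated_eq [LocallyCompactSpace G]
    [μ.InnerRegularCompactLTTop] (hU : IsContractiveRep U) (x : X) :
    ∃ (f : Lp ℂ 1 μ) (y : X), hU.integrated μ f y = x := by
  have hτ := isContractiveRep_translationLp μ 1 ENNReal.one_ne_top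
  refine exists_factorization_of_approximate_unit (hU.integrated μ) hU.norm_integrated_le
    (fun x p ε hε => ?_) x
  have h1 : ∀ᶠ z in 𝓝 (0 : G), ‖U z x - x‖ ≤ ε := by
    have : Filter.Tendsto (fun z => ‖U z x - x‖) (𝓝 0) (𝓝 0) := by
      have := (((hU.continuous x).sub continuous_const).norm.tendsto (0 : G) :
        Filter.Tendsto (fun z => ‖U z x - x‖) _ _)
      simpa [hU.map_zero] using this
    exact (this.eventually (gt_mem_nhds hε)).mono fun _ h => le_of_lt h
  have h2 : ∀ᶠ z in 𝓝 (0 : G), ‖translationLp μ 1 z p - p‖ ≤ ε := by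
    have : Filter.Tendsto (fun z => ‖translationLp μ 1 z p - p‖) (𝓝 0) (𝓝 0) := by
      have := (((hτ.continuous p).sub continuous_const).norm.tendsto (0 : G) :
        Filter.Tendsto (fun z => ‖translationLp μ 1 z p - p‖) _ _)
      simpa [hτ.map_zero] using this
    exact (this.eventually (gt_mem_nhds hε)).mono fun _ h => le_of_lt h
  obtain ⟨W, hW, hWfin⟩ := μ.finiteAt_nhds (0 : G)
  obtain ⟨V, hVsub, hVo, hV0⟩ := mem_nhds_iff.1 (Filter.inter_mem hW (h1.and h2))
  have hVfin : μ V ≠ ∞ := (measure_lt_top_mono (fun z hz => (hVsub hz).1) hWfin).ne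
  have hVpos : μ V ≠ 0 := (hVo.measure_pos μ ⟨0, hV0⟩).ne'
  have hreal : 0 < μ.real V := ENNReal.toReal_pos hVpos hVfin
  -- The unit `e` is the normalized indicator of `V`, and `q = e ∗ p`.
  refine ⟨indicatorConstLp 1 hVo.measurableSet hVfin (((μ.real V)⁻¹ : ℝ) : ℂ),
    hτ.integrated μ (indicatorConstLp 1 hVo.measurableSet hVfin (((μ.real V)⁻¹ : ℝ) : ℂ)) p,
    ?_, hU.integrated_integrated hτ _ _,
    hU.norm_integrated_indicator_sub_le hVo.measurableSet hVpos hVfin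
      fun z hz => (hVsub hz).2.1,
    hτ.norm_integrated_indicator_sub_le hVo.measurableSet hVpos hVfin
      fun z hz => (hVsub hz).2.2⟩
  rw [norm_indicatorConstLp one_ne_zero ENNReal.one_ne_top]
  simp only [Complex.norm_real, norm_inv, Real.norm_eq_abs, abs_of_pos hreal, ENNReal.toReal_one,
    div_one, Real.rpow_one]
  rw [inv_mul_cancel₀ hreal.ne']

/-- Factorization in a closed invariant subspace on which a representation by contractions is
strongly continuous. -/
theorem exists_integral_smul_eq_of_mem [LocallyCompactSpace G] [μ.InnerRegularCompactLTTop]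
    (U : G → X →L[ℂ] X) (hadd : ∀ z w x, U (z + w) x = U z (U w x)) (hzero : ∀ x, U 0 x = x)
    (hnorm : ∀ z x, ‖U z x‖ ≤ ‖x‖) (N : Submodule ℂ X) (hN : IsClosed (N : Set X))
    (hinv : ∀ z, ∀ x ∈ N, U z x ∈ N) (hcont : ∀ x ∈ N, Continuous fun z => U z x)
    {x : X} (hx : x ∈ N) :
    ∃ f : Lp ℂ 1 μ, ∃ y ∈ N, Integrable (fun z => f z • U z y) μ ∧ ∫ z, f z • U z y ∂μ = x := by
  have : CompleteSpace N := hN.completeSpace_coe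
  let V : G → N →L[ℂ] N := fun z => (U z ∘L N.subtypeL).codRestrict N fun x => hinv z x x.2
  have hV : IsContractiveRep V :=
    { map_add := fun z w x => Subtype.ext (hadd z w x)
      map_zero := fun x => Subtype.ext (hzero x)
      norm_le := fun z x => hnorm z x
      continuous := fun x => (hcont x x.2).subtype_mk _ }
  obtain ⟨f, y, hf⟩ := hV.exists_integrated_eq (μ := μ) ⟨x, hx⟩
  have hint := hV.integrable_smul (L1.integrable_coeFn f) y
  refine ⟨f, y, y.2, N.subtypeL.integrable_comp hint, ?_⟩
  have h := N.subtypeL.integral_comp_comm hint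
  rw [← hV.integrated_apply, hf] at h
  exact h

end Translation

/-! ### Singular value decomposition and a trace class criterion. -/

section SingularValues

universe u

variable {H : Type u} [NormedAddCommGroup H] [InnerProductSpace ℂ H]

theorem PhaseSpace.isTraceClass_of_countable {ι : Type*} [Countable ι] {A : H →L[ℂ] H} (s : ι → ℝ)
    (u v : ι → H) (hu : Orthonormal ℂ u) (hv : Orthonormal ℂ v) (hs : ∀ i, 0 < s i)
    (hsum : Summable s)
    (hA : ∀ ψ : H, HasSum (fun i => ((s i : ℂ) * inner ℂ (v i) ψ) • u i) (A ψ)) :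
    PhaseSpace.IsTraceClass A := by
  obtain ⟨f, hf⟩ := exists_injective_nat ι
  let e := (Equiv.ofInjective f hf).symm
  refine ⟨Set.range f, s ∘ e, u ∘ e, v ∘ e, hu.comp e e.injective, hv.comp e e.injective,
    fun i => hs _, e.summable_iff.2 hsum, fun ψ => ?_⟩
  exact e.hasSum_iff.2 (hA ψ)

variable [CompleteSpace H]

theorem exists_orthonormal_mem_topologicalClosure_span (K : Submodule ℂ H)
    (hK : IsClosed (K : Set H)) :
    ∃ (κ : Type u) (v : κ → K), Orthonormal ℂ v ∧
      ∀ x ∈ K, x ∈ (Submodule.span ℂ (Set.range fun i => (v i : H))).topologicalClosure := by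
  have : CompleteSpace K := hK.completeSpace_coe
  obtain ⟨w, b, -⟩ := exists_hilbertBasis ℂ K
  refine ⟨w, b, b.orthonormal, fun x hx => ?_⟩
  have h := K.subtypeL.hasSum (b.hasSum_repr ⟨x, hx⟩)
  refine mem_closure_of_tendsto h (Filter.Eventually.of_forall fun F => ?_)
  refine Submodule.sum_mem _ fun i _ => ?_
  simp only [map_smul]
  exact Submodule.smul_mem _ _ (Submodule.subset_span ⟨i, rfl⟩)

/-- A compact self-adjoint operator has a Hilbert basis of eigenvectors. -/
theorem exists_hilbertBasis_eigenvectors {T : H →L[ℂ] H} (hT : IsCompactOperator T)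
    (hT' : (T : H →ₗ[ℂ] H).IsSymmetric) :
    ∃ (ι : Type u) (b : HilbertBasis ι ℂ H) (μ : ι → ℂ), ∀ i, T (b i) = μ i • b i := by
  have hcl : ∀ μ : ℂ, IsClosed (Module.End.eigenspace (T : Module.End ℂ H) μ : Set H) := fun μ => by
    have : (Module.End.eigenspace (T : Module.End ℂ H) μ : Set H) = {x | T x = μ • x} := by
      ext x
      exact Module.End.mem_eigenspace_iff
    rw [this]
    exact isClosed_eq T.continuous (continuous_const_smul μ)
  choose κ v hv hspan using fun μ => exists_orthonormal_mem_topologicalClosure_span _ (hcl μ)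
  have hon : Orthonormal ℂ fun a : Σ μ : ℂ, κ μ => (v a.1 a.2 : H) :=
    hT'.orthogonalFamily_eigenspaces.orthonormal_sigma_orthonormal hv
  have hbot : (Submodule.span ℂ (Set.range fun a : Σ μ : ℂ, κ μ => (v a.1 a.2 : H)))ᗮ = ⊥ := by
    rw [eq_bot_iff, ← ContinuousLinearMap.orthogonalComplement_iSup_eigenspaces_eq_bot hT hT',
      ← Submodule.orthogonal_closure (K := Submodule.span ℂ _)]
    refine Submodule.orthogonal_le (iSup_le fun μ x hx => ?_)
    refine Submodule.topologicalClosure_mono (Submodule.span_mono ?_) (hspan μ x hx)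
    rintro _ ⟨i, rfl⟩
    exact ⟨⟨μ, i⟩, rfl⟩
  refine ⟨_, HilbertBasis.mkOfOrthogonalEqBot hon hbot, fun a => a.1, fun a => ?_⟩
  rw [HilbertBasis.coe_mkOfOrthogonalEqBot]
  exact Module.End.mem_eigenspace_iff.1 (v a.1 a.2).2

/-- An operator whose traces against partial isometries of finite rank are bounded is of trace
class as soon as it is compact. -/
theorem PhaseSpace.isTraceClass_of_isCompactOperator {A : H →L[ℂ] H}
    (hc : IsCompactOperator (ContinuousLinearMap.adjoint A ∘L A)) (C : ℝ)
    (hC : ∀ {ι : Type u} (F : Finset ι) (u v : ι → H), Orthonormal ℂ u → Orthonormal ℂ v →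
      ‖∑ i ∈ F, inner ℂ (u i) (A (v i))‖ ≤ C) :
    PhaseSpace.IsTraceClass A := by
  obtain ⟨ι, b, μ, hb⟩ := exists_hilbertBasis_eigenvectors hc
    (fun x y => by
      simp [ContinuousLinearMap.adjoint_inner_left, ContinuousLinearMap.adjoint_inner_right])
  -- The vectors `A (b i)` are orthogonal, `b` being an eigenbasis of `A* A`; normalizing the
  -- nonzero ones gives the left singular vectors, with singular values `‖A (b i)‖`.
  let J := {i : ι // A (b i) ≠ 0}
  let u : J → H := fun i => ((‖A (b i)‖⁻¹ : ℝ) : ℂ) • A (b i)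
  have hpos : ∀ i : J, 0 < ‖A (b i)‖ := fun i => norm_pos_iff.2 i.2
  have hv : Orthonormal ℂ fun i : J => b i := b.orthonormal.comp _ Subtype.val_injective
  have hu : Orthonormal ℂ u := by
    refine ⟨fun i => ?_, fun i j hij => ?_⟩
    · simp only [u, norm_smul, Complex.norm_real, norm_inv, norm_norm]
      exact inv_mul_cancel₀ (hpos i).ne'
    · have h : inner ℂ (A (b i)) (A (b j)) = 0 := by
        rw [← ContinuousLinearMap.adjoint_inner_right, ← ContinuousLinearMap.comp_apply, hb,
          inner_smul_right, b.orthonormal.2 (fun h => hij (Subtype.ext h)), mul_zero]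
      simp only [u, inner_smul_left, inner_smul_right, h, mul_zero]
  have hinner : ∀ i : J, inner ℂ (u i) (A (b i)) = ((‖A (b i)‖ : ℝ) : ℂ) := fun i => by
    have h0 : ((‖A (b i)‖ : ℝ) : ℂ) ≠ 0 := by exact_mod_cast (hpos i).ne'
    rw [inner_smul_left, inner_self_eq_norm_sq_to_K, Complex.conj_ofReal, Complex.ofReal_inv]
    exact (inv_mul_eq_iff_eq_mul₀ h0).2 (sq _)
  have hsum : Summable fun i : J => ‖A (b i)‖ := by
    refine summable_of_sum_le (fun i => (hpos i).le) (c := C) fun F => ?_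
    have := hC F u (fun i => b i) hu hv
    rw [Finset.sum_congr rfl fun i _ => hinner i, ← Complex.ofReal_sum, Complex.norm_real] at this
    exact (le_abs_self _).trans this
  -- The space need not be separable; a summable family of positive numbers has a countable index
  -- set.
  have : Countable J := by
    have h := hsum.countable_support
    rw [Function.support_eq_univ fun i => (hpos i).ne'] at h
    exact Set.countable_univ_iff.1 h
  refine PhaseSpace.isTraceClass_of_countable (fun i : J => ‖A (b i)‖) u (fun i => b i) hu hv hpos
    hsum fun ψ => ?_
  have h1 := A.hasSum (b.hasSum_repr ψ)
  have h2 : HasSum ((fun i => A (b.repr ψ i • b i)) ∘ ((↑) : J → ι)) (A ψ) := by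
    refine (Subtype.val_injective.hasSum_iff fun i hi => ?_).2 h1
    have : A (b i) = 0 := by
      by_contra h
      exact hi ⟨⟨i, h⟩, rfl⟩
    rw [map_smul, this, smul_zero]
  convert h2 using 2 with i
  have h0 : ((‖A (b i)‖ : ℝ) : ℂ) ≠ 0 := by exact_mod_cast (hpos i).ne'
  simp only [u, Function.comp_apply, map_smul, b.repr_apply_apply, smul_smul, Complex.ofReal_inv]
  congr 1
  field_simp

end SingularValues

/-! ### Time-frequency shifts as a projective representation. -/

namespace PhaseSpace

variable {d : ℕ}

theorem character_add_left (ω ω' t : Pos d) :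
    character (ω + ω') t = character ω t * character ω' t := by
  simp only [character, ← Complex.exp_add, inner_add_left, Complex.ofReal_add, mul_add]

theorem character_add_right (ω t s : Pos d) :
    character ω (t + s) = character ω t * character ω s := by
  simp only [character, ← Complex.exp_add, inner_add_right, Complex.ofReal_add, mul_add]

theorem coeFn_modulation (ω : Pos d) (ψ : L2 d) :
    modulation ω ψ =ᵐ[volume] fun t => character ω t * ψ t :=
  (memLp_character_mul ω ψ).coeFn_toLp

theorem coeFn_translation (x : Pos d) (ψ : L2 d) :
    translation x ψ =ᵐ[volume] fun t => ψ (t - x) :=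
  coeFn_translationLp volume x ψ

theorem norm_modulation (ω : Pos d) (ψ : L2 d) : ‖modulation ω ψ‖ = ‖ψ‖ := by
  refine le_antisymm (Lp.norm_le_norm_of_ae_le ?_) (Lp.norm_le_norm_of_ae_le ?_) <;>
  · filter_upwards [coeFn_modulation ω ψ] with t ht
    rw [ht, norm_mul, norm_character, one_mul]

/-- Weak continuity follows by dominated convergence; since the norm is preserved, it upgrades to
strong continuity. -/
theorem continuous_modulation (ψ : L2 d) : Continuous fun ω => modulation ω ψ := by
  have hweak : ∀ φ : L2 d, Continuous fun ω => inner ℂ φ (modulation ω ψ) := fun φ => by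
    have h : ∀ ω, inner ℂ φ (modulation ω ψ) = ∫ t, character ω t * inner ℂ (φ t) (ψ t) := by
      intro ω
      rw [L2.inner_def]
      refine integral_congr_ae ?_
      filter_upwards [coeFn_modulation ω ψ] with t ht
      rw [ht, ← smul_eq_mul, inner_smul_right]
    simp only [h]
    have hint := L2.integrable_inner (𝕜 := ℂ) φ ψ
    refine continuous_of_dominated (bound := fun t => ‖inner ℂ (φ t) (ψ t)‖) (fun ω => ?_)
      (fun ω => Filter.Eventually.of_forall fun t => ?_) hint.norm
      (Filter.Eventually.of_forall fun t => ?_)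
    · exact (continuous_character ω).aestronglyMeasurable.mul hint.aestronglyMeasurable
    · rw [norm_mul, norm_character, one_mul]
    · unfold character
      fun_prop
  refine continuous_iff_continuousAt.2 fun ω₀ => ?_
  rw [ContinuousAt, tendsto_iff_norm_sub_tendsto_zero]
  have hsq : Filter.Tendsto (fun ω => ‖modulation ω ψ - modulation ω₀ ψ‖ ^ 2) (𝓝 ω₀) (𝓝 0) := by
    have h1 : ∀ ω, ‖modulation ω ψ - modulation ω₀ ψ‖ ^ 2 =
        2 * ‖ψ‖ ^ 2 - 2 * (inner ℂ (modulation ω₀ ψ) (modulation ω ψ)).re := fun ω => by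
      rw [norm_sub_rev, @norm_sub_sq ℂ, norm_modulation, norm_modulation, RCLike.re_to_complex]
      ring
    have h2 : Continuous fun ω => ‖modulation ω ψ - modulation ω₀ ψ‖ ^ 2 := by
      simp only [h1]
      exact continuous_const.sub (continuous_const.mul
        (Complex.continuous_re.comp (hweak (modulation ω₀ ψ))))
    simpa using h2.tendsto ω₀
  simpa [Real.sqrt_sq (norm_nonneg _)] using hsq.sqrt

theorem norm_timeFreqShift (z : Phase d) (ψ : L2 d) : ‖timeFreqShift z ψ‖ = ‖ψ‖ := by
  rw [timeFreqShift, ContinuousLinearMap.comp_apply, norm_modulation]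
  exact norm_translationLp volume z.1 ψ

theorem opNorm_timeFreqShift_le (z : Phase d) : ‖timeFreqShift z‖ ≤ 1 :=
  ContinuousLinearMap.opNorm_le_bound _ zero_le_one fun ψ => by rw [norm_timeFreqShift, one_mul]

theorem continuous_timeFreqShift (ψ : L2 d) : Continuous fun z : Phase d => timeFreqShift z ψ := by
  refine continuous_iff_continuousAt.2 fun z₀ => ?_
  rw [ContinuousAt, tendsto_iff_norm_sub_tendsto_zero]
  have h1 : Continuous fun x : Pos d => translation x ψ :=
    (isContractiveRep_translationLp (volume : Measure (Pos d)) 2 ENNReal.ofNat_ne_top).continuous ψ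
  have h2 := continuous_modulation (translation z₀.1 ψ)
  have h3 : Filter.Tendsto (fun z : Phase d => ‖translation z.1 ψ - translation z₀.1 ψ‖ +
      ‖modulation z.2 (translation z₀.1 ψ) - modulation z₀.2 (translation z₀.1 ψ)‖) (𝓝 z₀)
      (𝓝 0) := by
    have : Continuous (fun z : Phase d => ‖translation z.1 ψ - translation z₀.1 ψ‖ +
      ‖modulation z.2 (translation z₀.1 ψ) - modulation z₀.2 (translation z₀.1 ψ)‖) :=
      ((h1.comp continuous_fst).sub continuous_const).norm.add
        ((h2.comp continuous_snd).sub continuous_const).norm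
    simpa using this.tendsto z₀
  refine squeeze_zero (fun _ => norm_nonneg _) (fun z => ?_) h3
  -- Modulation is isometric, so the translation error is bounded uniformly in the frequency.
  have h4 : timeFreqShift z ψ - timeFreqShift z₀ ψ =
      modulation z.2 (translation z.1 ψ - translation z₀.1 ψ) +
      (modulation z.2 (translation z₀.1 ψ) - modulation z₀.2 (translation z₀.1 ψ)) := by
    rw [map_sub, sub_add_sub_cancel]
    rfl
  rw [h4]
  refine (norm_add_le _ _).trans ?_
  rw [norm_modulation]

theorem timeFreqShift_zero : timeFreqShift (0 : Phase d) = 1 := by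
  ext1 ψ
  refine Lp.ext ?_
  filter_upwards [coeFn_modulation (0 : Phase d).2 (translation (0 : Phase d).1 ψ),
    coeFn_translation (0 : Phase d).1 ψ] with t h1 h2
  rw [timeFreqShift, ContinuousLinearMap.comp_apply, h1, h2]
  simp [character]

/-- The phase arises because the translation by `z.1` also shifts the argument of the character of
`w.2`. -/
theorem timeFreqShift_comp (z w : Phase d) :
    timeFreqShift z ∘L timeFreqShift w = character w.2 (-z.1) • timeFreqShift (z + w) := by
  ext1 ψ
  refine Lp.ext ?_
  have hq := (measurePreserving_sub_right (volume : Measure (Pos d)) z.1).quasiMeasurePreserving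
  filter_upwards [coeFn_modulation z.2 (translation z.1 (timeFreqShift w ψ)),
    coeFn_translation z.1 (timeFreqShift w ψ),
    hq.ae (coeFn_modulation w.2 (translation w.1 ψ)),
    hq.ae (coeFn_translation w.1 ψ),
    Lp.coeFn_smul (character w.2 (-z.1)) (timeFreqShift (z + w) ψ),
    coeFn_modulation (z + w).2 (translation (z + w).1 ψ),
    coeFn_translation (z + w).1 ψ] with t h1 h2 h3 h4 h5 h6 h7
  have e1 : (timeFreqShift z ∘L timeFreqShift w) ψ =
    modulation z.2 (translation z.1 (timeFreqShift w ψ)) := rfl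
  have e2 : timeFreqShift w ψ = modulation w.2 (translation w.1 ψ) := rfl
  have e3 : timeFreqShift (z + w) ψ = modulation (z + w).2 (translation (z + w).1 ψ) := rfl
  rw [e1, h1, h2, e2, h3, h4, smul_apply, h5, Pi.smul_apply, e3, h6, h7, smul_eq_mul,
    Prod.snd_add, Prod.fst_add, character_add_left, sub_sub, sub_eq_add_neg t z.1,
    character_add_right]
  ring

end PhaseSpace

/-! ### Functionals on bounded operators and the operators they represent. -/

section NormalFunctional

variable {H : Type*} [NormedAddCommGroup H] [InnerProductSpace ℂ H]

/-- The functional `B ↦ ⟨b, B a⟩` on bounded operators. -/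
noncomputable def vectorFunctional (a b : H) : StrongDual ℂ (H →L[ℂ] H) :=
  innerSL ℂ b ∘L ContinuousLinearMap.apply ℂ H a

theorem vectorFunctional_apply (a b : H) (B : H →L[ℂ] H) :
    vectorFunctional a b B = inner ℂ b (B a) := rfl

theorem norm_vectorFunctional_le (a b : H) : ‖vectorFunctional a b‖ ≤ ‖a‖ * ‖b‖ := by
  refine ContinuousLinearMap.opNorm_le_bound _ (by positivity) fun B => ?_
  rw [vectorFunctional_apply]
  calc ‖inner ℂ b (B a)‖ ≤ ‖b‖ * ‖B a‖ := norm_inner_le_norm _ _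
    _ ≤ ‖b‖ * (‖B‖ * ‖a‖) := by gcongr; exact B.le_opNorm a
    _ = ‖a‖ * ‖b‖ * ‖B‖ := by ring

theorem continuous_vectorFunctional :
    Continuous fun q : H × H => vectorFunctional q.1 q.2 := by
  unfold vectorFunctional
  exact ((innerSL ℂ).continuous.comp continuous_snd).clm_comp
    ((ContinuousLinearMap.apply ℂ H).continuous.comp continuous_fst)

theorem isCompactOperator_rankOne (a b : H) : IsCompactOperator (rankOne ℂ a b : H →L[ℂ] H) := by
  rw [InnerProductSpace.rankOne_def']
  exact ((isCompactOperator_id (E := ℂ)).comp_clm (innerSL ℂ b)).clm_comp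
    (ContinuousLinearMap.toSpanSingleton ℂ a)

/-- Orthonormality of `u` reduces this to Bessel's inequality for `v`. -/
theorem norm_sum_rankOne_le {ι : Type*} (F : Finset ι) {u v : ι → H} (hu : Orthonormal ℂ u)
    (hv : Orthonormal ℂ v) : ‖∑ i ∈ F, rankOne ℂ (u i) (v i)‖ ≤ 1 := by
  refine ContinuousLinearMap.opNorm_le_bound _ zero_le_one fun x => ?_
  rw [one_mul]
  refine le_of_sq_le_sq ?_ (norm_nonneg _)
  refine le_trans (le_of_eq ?_) (hv.sum_inner_products_le x (s := F))
  simp only [sum_apply, InnerProductSpace.rankOne_apply]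
  have h := hu.inner_sum (fun i => inner ℂ (v i) x) (fun i => inner ℂ (v i) x) F
  rw [inner_self_eq_norm_sq_to_K] at h
  have h2 : ∀ i, (starRingEnd ℂ) (inner ℂ (v i) x) * inner ℂ (v i) x =
      ((‖inner ℂ (v i) x‖ ^ 2 : ℝ) : ℂ) := fun i => by
    rw [mul_comm, Complex.mul_conj, Complex.normSq_eq_norm_sq]
  simp only [h2] at h
  rw [← Complex.ofReal_sum] at h
  exact Complex.ofReal_injective ((Complex.ofReal_pow _ 2).trans h)

variable [CompleteSpace H]

/-- The operator `A` with `⟨η, A ψ⟩ = φ(|ψ⟩⟨η|)`; if `φ` is the functional `B ↦ tr (A B)`, then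
this is `A`. -/
noncomputable def operatorOfFunctional :
    StrongDual ℂ (H →L[ℂ] H) →ₗ[ℂ] H →L[ℂ] H where
  toFun φ := ContinuousLinearMap.adjoint (InnerProductSpace.continuousLinearMapOfBilin
    ((ContinuousLinearMap.compL ℂ H (H →L[ℂ] H) ℂ φ).comp (rankOne ℂ).flip))
  map_add' φ φ' := by
    ext1 ψ
    refine ext_inner_left ℂ fun η => ?_
    simp [ContinuousLinearMap.adjoint_inner_right, inner_add_right,
      InnerProductSpace.continuousLinearMapOfBilin_apply]
  map_smul' c φ := by
    ext1 ψ
    refine ext_inner_left ℂ fun η => ?_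
    simp [ContinuousLinearMap.adjoint_inner_right, inner_smul_right,
      InnerProductSpace.continuousLinearMapOfBilin_apply]

theorem inner_operatorOfFunctional (φ : StrongDual ℂ (H →L[ℂ] H)) (η ψ : H) :
    inner ℂ η (operatorOfFunctional φ ψ) = φ (rankOne ℂ ψ η) := by
  simp [operatorOfFunctional, ContinuousLinearMap.adjoint_inner_right,
    InnerProductSpace.continuousLinearMapOfBilin_apply]

theorem norm_operatorOfFunctional_le (φ : StrongDual ℂ (H →L[ℂ] H)) :
    ‖operatorOfFunctional φ‖ ≤ ‖φ‖ := by
  refine ContinuousLinearMap.opNorm_le_bound _ (norm_nonneg _) fun ψ => ?_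
  -- Pairing `χ` with itself gives `‖χ‖² = φ(|ψ⟩⟨χ|)`, and the rank one operator has norm `‖ψ‖ ‖χ‖`.
  set χ := operatorOfFunctional φ ψ with hχ
  have h1 : ‖χ‖ * ‖χ‖ ≤ ‖φ‖ * ‖ψ‖ * ‖χ‖ := by
    have h2 := inner_operatorOfFunctional φ χ ψ
    rw [← hχ] at h2
    calc ‖χ‖ * ‖χ‖ = ‖inner ℂ χ χ‖ := by rw [inner_self_eq_norm_sq_to_K]; simp [sq]
      _ ≤ ‖φ‖ * ‖rankOne ℂ ψ χ‖ := by rw [h2]; exact φ.le_opNorm _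
      _ = _ := by rw [InnerProductSpace.norm_rankOne, mul_assoc]
  rcases eq_or_ne χ 0 with h | h
  · rw [h, norm_zero]
    positivity
  · exact le_of_mul_le_mul_right h1 (norm_pos_iff.2 h)

theorem operatorOfFunctional_vectorFunctional (a b : H) :
    operatorOfFunctional (vectorFunctional a b) = rankOne ℂ a b := by
  ext1 ψ
  refine ext_inner_left ℂ fun η => ?_
  rw [inner_operatorOfFunctional, vectorFunctional_apply, InnerProductSpace.rankOne_apply,
    InnerProductSpace.rankOne_apply, inner_smul_right, inner_smul_right, mul_comm]

/-- The traces in the criterion are conjugates of values of `φ` on finite rank partial isometries,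
so `‖φ‖` bounds them. -/
theorem isTraceClass_adjoint_operatorOfFunctional {φ : StrongDual ℂ (H →L[ℂ] H)}
    (hφ : IsCompactOperator (operatorOfFunctional φ)) :
    PhaseSpace.IsTraceClass (ContinuousLinearMap.adjoint (operatorOfFunctional φ)) := by
  refine PhaseSpace.isTraceClass_of_isCompactOperator ?_ ‖φ‖ fun F u v hu hv => ?_
  · rw [ContinuousLinearMap.adjoint_adjoint]
    exact hφ.comp_clm _
  · have h : ∑ i ∈ F, inner ℂ (u i) (ContinuousLinearMap.adjoint (operatorOfFunctional φ) (v i)) =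
        (starRingEnd ℂ) (φ (∑ i ∈ F, rankOne ℂ (u i) (v i))) := by
      rw [map_sum, map_sum]
      refine Finset.sum_congr rfl fun i _ => ?_
      rw [ContinuousLinearMap.adjoint_inner_right, ← inner_operatorOfFunctional, inner_conj_symm]
    rw [h, RCLike.norm_conj]
    refine (φ.le_opNorm _).trans ?_
    exact mul_le_of_le_one_right (norm_nonneg _) (norm_sum_rankOne_le F hu hv)

theorem continuous_operatorOfFunctional :
    Continuous (operatorOfFunctional : StrongDual ℂ (H →L[ℂ] H) →ₗ[ℂ] H →L[ℂ] H) :=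
  AddMonoidHomClass.continuous_of_bound _ 1 fun φ => by
    rw [one_mul]
    exact norm_operatorOfFunctional_le φ

end NormalFunctional

/-! ### Conjugation by a projective representation, and its regular functionals. -/

/-- Contractivity makes orbits of nearby vectors uniformly close, and uniform limits of continuous
maps are continuous. -/
theorem isClosed_setOf_continuous_orbit {G X : Type*} [TopologicalSpace G] [NormedAddCommGroup X]
    [NormedSpace ℂ X] (U : G → X →L[ℂ] X) (hU : ∀ z x, ‖U z x‖ ≤ ‖x‖) :
    IsClosed {x : X | Continuous fun z => U z x} := by
  refine isClosed_of_closure_subset fun x hx => ?_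
  refine continuous_of_uniform_approx_of_continuous fun u hu => ?_
  obtain ⟨ε, hε, hεu⟩ := Metric.mem_uniformity_dist.1 hu
  obtain ⟨y, hy, hxy⟩ := Metric.mem_closure_iff.1 hx ε hε
  refine ⟨_, hy, fun z => hεu ?_⟩
  rw [dist_eq_norm, ← map_sub]
  exact (hU z _).trans_lt (by rwa [← dist_eq_norm])

section ProjectiveRep

variable {G H : Type*} [AddCommGroup G] [TopologicalSpace G]
  [NormedAddCommGroup H] [InnerProductSpace ℂ H]

/-- A strongly continuous projective representation of an additive group by contractions of a
Hilbert space. -/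
structure IsProjectiveRep (π : G → H →L[ℂ] H) : Prop where
  comp : ∀ z w, ∃ c : ℂ, ‖c‖ = 1 ∧ π z ∘L π w = c • π (z + w)
  map_zero : π 0 = 1
  norm_le : ∀ z, ‖π z‖ ≤ 1
  continuous : ∀ ψ, Continuous fun z => π z ψ

variable [CompleteSpace H]

/-- The conjugation of operators `B ↦ T* B T`. -/
noncomputable def conjOperator (T : H →L[ℂ] H) : (H →L[ℂ] H) →L[ℂ] H →L[ℂ] H :=
  ContinuousLinearMap.compL ℂ H H H (ContinuousLinearMap.adjoint T) ∘L
    (ContinuousLinearMap.compL ℂ H H H).flip T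

theorem conjOperator_apply (T B : H →L[ℂ] H) :
    conjOperator T B = ContinuousLinearMap.adjoint T ∘L B ∘L T := rfl

theorem opNorm_conjOperator_le {T : H →L[ℂ] H} (hT : ‖T‖ ≤ 1) : ‖conjOperator T‖ ≤ 1 := by
  refine ContinuousLinearMap.opNorm_le_bound _ zero_le_one fun B => ?_
  have h1 : ‖ContinuousLinearMap.adjoint T‖ ≤ 1 := (LinearIsometryEquiv.norm_map _ _).trans_le hT
  calc ‖conjOperator T B‖ ≤ ‖ContinuousLinearMap.adjoint T‖ * (‖B‖ * ‖T‖) :=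
        (ContinuousLinearMap.opNorm_comp_le _ _).trans
          (mul_le_mul_of_nonneg_left (ContinuousLinearMap.opNorm_comp_le _ _) (norm_nonneg _))
    _ ≤ 1 * (‖B‖ * 1) := by gcongr
    _ = 1 * ‖B‖ := by ring

/-- This makes conjugation by a projective representation a genuine representation. -/
theorem conjOperator_smul {c : ℂ} (hc : ‖c‖ = 1) (T B : H →L[ℂ] H) :
    conjOperator (c • T) B = conjOperator T B := by
  have hc' : (starRingEnd ℂ) c * c = 1 := by
    rw [mul_comm, Complex.mul_conj, Complex.normSq_eq_norm_sq, hc]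
    norm_num
  rw [conjOperator_apply, conjOperator_apply, map_smulₛₗ, ContinuousLinearMap.smul_comp,
    ContinuousLinearMap.comp_smul, ContinuousLinearMap.comp_smul, smul_smul, hc', one_smul]

theorem conjOperator_comp (T R B : H →L[ℂ] H) :
    conjOperator (T ∘L R) B = conjOperator R (conjOperator T B) := by
  simp only [conjOperator_apply, ContinuousLinearMap.adjoint_comp, ContinuousLinearMap.comp_assoc]

theorem conjOperator_one (B : H →L[ℂ] H) : conjOperator 1 B = B := by
  ext1 ψ
  refine ext_inner_left ℂ fun η => ?_
  rw [conjOperator_apply, ContinuousLinearMap.comp_apply, ContinuousLinearMap.adjoint_inner_right]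
  rfl

/-- The action on functionals that corresponds to `A ↦ T A T*` on operators. -/
noncomputable def conjFunctional (T : H →L[ℂ] H) :
    StrongDual ℂ (H →L[ℂ] H) →L[ℂ] StrongDual ℂ (H →L[ℂ] H) :=
  (ContinuousLinearMap.compL ℂ (H →L[ℂ] H) (H →L[ℂ] H) ℂ).flip (conjOperator T)

theorem conjFunctional_apply (T : H →L[ℂ] H) (φ : StrongDual ℂ (H →L[ℂ] H))
    (B : H →L[ℂ] H) : conjFunctional T φ B = φ (conjOperator T B) := rfl

theorem norm_conjFunctional_le {T : H →L[ℂ] H} (hT : ‖T‖ ≤ 1) (φ : StrongDual ℂ (H →L[ℂ] H)) :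
    ‖conjFunctional T φ‖ ≤ ‖φ‖ :=
  (ContinuousLinearMap.opNorm_comp_le φ (conjOperator T)).trans
    (mul_le_of_le_one_right (norm_nonneg _) (opNorm_conjOperator_le hT))

theorem IsProjectiveRep.conjFunctional_add {π : G → H →L[ℂ] H} (hπ : IsProjectiveRep π) (z w : G)
    (φ : StrongDual ℂ (H →L[ℂ] H)) :
    conjFunctional (π (z + w)) φ = conjFunctional (π z) (conjFunctional (π w) φ) := by
  obtain ⟨c, hc, h⟩ := hπ.comp z w
  ext1 B
  rw [conjFunctional_apply, conjFunctional_apply, conjFunctional_apply, ← conjOperator_comp, h,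
    conjOperator_smul hc]

theorem conjFunctional_one (φ : StrongDual ℂ (H →L[ℂ] H)) : conjFunctional 1 φ = φ := by
  ext1 B
  rw [conjFunctional_apply, conjOperator_one]

theorem conjFunctional_vectorFunctional (T : H →L[ℂ] H) (a b : H) :
    conjFunctional T (vectorFunctional a b) = vectorFunctional (T a) (T b) := by
  ext1 B
  rw [conjFunctional_apply, conjOperator_apply, vectorFunctional_apply, vectorFunctional_apply,
    ContinuousLinearMap.comp_apply, ContinuousLinearMap.adjoint_inner_right]
  rfl

theorem operatorOfFunctional_conjFunctional (T : H →L[ℂ] H) (φ : StrongDual ℂ (H →L[ℂ] H)) :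
    operatorOfFunctional (conjFunctional T φ) =
      T ∘L operatorOfFunctional φ ∘L ContinuousLinearMap.adjoint T := by
  ext1 ψ
  refine ext_inner_left ℂ fun η => ?_
  rw [inner_operatorOfFunctional, conjFunctional_apply, conjOperator_apply,
    ContinuousLinearMap.comp_apply, ContinuousLinearMap.comp_apply,
    ← ContinuousLinearMap.adjoint_inner_left, inner_operatorOfFunctional,
    InnerProductSpace.rankOne_comp, InnerProductSpace.comp_rankOne]

/-- The functionals with continuous orbit whose operator is compact; they include the trace class
operators. -/
noncomputable def regularFunctionals (π : G → H →L[ℂ] H) :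
    Submodule ℂ (StrongDual ℂ (H →L[ℂ] H)) where
  carrier := {φ | Continuous (fun z => conjFunctional (π z) φ) ∧
    IsCompactOperator (operatorOfFunctional φ)}
  add_mem' := fun ⟨h1, h2⟩ ⟨h3, h4⟩ => by
    refine ⟨?_, ?_⟩
    · simp only [map_add]
      exact h1.add h3
    · rw [map_add]
      exact h2.add h4
  zero_mem' := by
    refine ⟨?_, ?_⟩
    · simp only [map_zero]
      exact continuous_const
    · rw [map_zero]
      exact isCompactOperator_zero
  smul_mem' := fun c φ ⟨h1, h2⟩ => by
    refine ⟨?_, ?_⟩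
    · simp only [map_smul]
      exact h1.const_smul c
    · rw [map_smul]
      exact h2.smul c

variable {π : G → H →L[ℂ] H}

omit [AddCommGroup G] in
theorem mem_regularFunctionals {φ : StrongDual ℂ (H →L[ℂ] H)} :
    φ ∈ regularFunctionals π ↔ Continuous (fun z => conjFunctional (π z) φ) ∧
      IsCompactOperator (operatorOfFunctional φ) := Iff.rfl

theorem IsProjectiveRep.isClosed_regularFunctionals (hπ : IsProjectiveRep π) :
    IsClosed (regularFunctionals π : Set (StrongDual ℂ (H →L[ℂ] H))) := by
  have h1 : IsClosed {φ : StrongDual ℂ (H →L[ℂ] H) |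
      Continuous fun z => conjFunctional (π z) φ} :=
    isClosed_setOf_continuous_orbit (fun z => conjFunctional (π z))
      fun z => norm_conjFunctional_le (hπ.norm_le z)
  have h2 : IsClosed {A : H →L[ℂ] H | IsCompactOperator A} :=
    isClosed_setOfPred_isCompactOperator
  exact h1.inter (h2.preimage continuous_operatorOfFunctional)

theorem IsProjectiveRep.conjFunctional_mem_regularFunctionals [ContinuousAdd G]
    (hπ : IsProjectiveRep π) (z : G) {φ : StrongDual ℂ (H →L[ℂ] H)}
    (hφ : φ ∈ regularFunctionals π) : conjFunctional (π z) φ ∈ regularFunctionals π := by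
  rw [mem_regularFunctionals] at hφ ⊢
  refine ⟨?_, ?_⟩
  · simp only [← hπ.conjFunctional_add]
    exact hφ.1.comp (continuous_id.add continuous_const)
  · rw [operatorOfFunctional_conjFunctional]
    exact (hφ.2.comp_clm _).clm_comp (π z)

theorem IsProjectiveRep.vectorFunctional_mem_regularFunctionals (hπ : IsProjectiveRep π)
    (a b : H) : vectorFunctional a b ∈ regularFunctionals π := by
  rw [mem_regularFunctionals]
  refine ⟨?_, ?_⟩
  · simp only [conjFunctional_vectorFunctional]
    exact continuous_vectorFunctional.comp ((hπ.continuous a).prodMk (hπ.continuous b))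
  · rw [operatorOfFunctional_vectorFunctional]
    exact isCompactOperator_rankOne a b

/-- The singular value decomposition of `S`, read as a series of vector functionals, converges
absolutely in the dual norm. Each term is regular, and closedness passes this on to the sum. -/
theorem IsProjectiveRep.exists_operatorOfFunctional_eq (hπ : IsProjectiveRep π) {S : H →L[ℂ] H}
    (hS : PhaseSpace.IsTraceClass S) :
    ∃ φ ∈ regularFunctionals π, operatorOfFunctional φ = S := by
  obtain ⟨J, s, u, v, hu, hv, hs, hsum, hS⟩ := hS
  have hsummable : Summable fun i => (s i : ℂ) • vectorFunctional (u i) (v i) := by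
    refine Summable.of_norm_bounded hsum fun i => ?_
    rw [norm_smul, Complex.norm_real, Real.norm_eq_abs, abs_of_pos (hs i)]
    refine mul_le_of_le_one_right (hs i).le ((norm_vectorFunctional_le _ _).trans ?_)
    rw [hu.1, hv.1, one_mul]
  obtain ⟨φ, hφ⟩ := hsummable
  refine ⟨φ, hπ.isClosed_regularFunctionals.mem_of_tendsto hφ
    (Filter.Eventually.of_forall fun F => Submodule.sum_mem _ fun i _ => Submodule.smul_mem _ _
      (hπ.vectorFunctional_mem_regularFunctionals _ _)), ?_⟩
  ext1 ψ
  refine ext_inner_left ℂ fun η => ?_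
  rw [inner_operatorOfFunctional]
  refine ((ContinuousLinearMap.apply ℂ ℂ (rankOne ℂ ψ η)).hasSum hφ).unique
    (cast (congrArg (HasSum · _) (funext fun i => ?_)) ((innerSL ℂ η).hasSum (hS ψ)))
  rw [map_smul, ContinuousLinearMap.apply_apply, innerSL_apply_apply, smul_apply, vectorFunctional_apply, InnerProductSpace.rankOne_apply,
    inner_smul_right, smul_eq_mul, smul_eq_mul, mul_assoc, mul_comm (inner ℂ (v i) ψ)]

end ProjectiveRep

/-! ### Factorization of trace class operators. -/

/-- Every trace class operator is the integral of a trace class operator, shifted by a projective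
representation, against an integrable function. -/
theorem IsProjectiveRep.exists_isWeakIntegral {G H : Type*} [NormedAddCommGroup G]
    [MeasurableSpace G] [BorelSpace G] [SecondCountableTopology G] [LocallyCompactSpace G]
    (μ : Measure G) [μ.IsAddHaarMeasure] [μ.InnerRegularCompactLTTop]
    [NormedAddCommGroup H] [InnerProductSpace ℂ H] [CompleteSpace H]
    {π : G → H →L[ℂ] H} (hπ : IsProjectiveRep π) {S : H →L[ℂ] H}
    (hS : PhaseSpace.IsTraceClass S) :
    ∃ σ : H →L[ℂ] H, PhaseSpace.IsTraceClass σ ∧ ∃ f : G → ℂ, Integrable f μ ∧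
      PhaseSpace.IsWeakIntegral μ (fun y => f y • (π y ∘L ContinuousLinearMap.adjoint σ ∘L
        ContinuousLinearMap.adjoint (π y))) S := by
  obtain ⟨φ, hφ, rfl⟩ := hπ.exists_operatorOfFunctional_eq hS
  obtain ⟨f, χ, hχ, hint, hf⟩ := exists_integral_smul_eq_of_mem (μ := μ)
    (fun z => conjFunctional (π z)) hπ.conjFunctional_add
    (fun φ => (congrArg (fun T => conjFunctional T φ) hπ.map_zero).trans (conjFunctional_one φ))
    (fun z => norm_conjFunctional_le (hπ.norm_le z)) (regularFunctionals π)
    hπ.isClosed_regularFunctionals (fun z _ => hπ.conjFunctional_mem_regularFunctionals z)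
    (fun _ h => h.1) hφ
  -- It is `σ*` that gets shifted, so `σ` is the adjoint of the operator of `χ`.
  refine ⟨ContinuousLinearMap.adjoint (operatorOfFunctional χ),
    isTraceClass_adjoint_operatorOfFunctional hχ.2, f, L1.integrable_coeFn f, fun η ψ => ?_⟩
  rw [ContinuousLinearMap.adjoint_adjoint]
  -- Evaluation at `|ψ⟩⟨η|` is continuous, so the norm-convergent integral of functionals yields the
  -- weak integral of operators.
  let L : StrongDual ℂ (H →L[ℂ] H) →L[ℂ] ℂ := ContinuousLinearMap.apply ℂ ℂ (rankOne ℂ ψ η)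
  have hL : ∀ y, inner ℂ η ((f y • (π y ∘L operatorOfFunctional χ ∘L
      ContinuousLinearMap.adjoint (π y))) ψ) = L (f y • conjFunctional (π y) χ) := fun y => by
    rw [map_smul, smul_apply, inner_smul_right, ← operatorOfFunctional_conjFunctional,
      inner_operatorOfFunctional, smul_eq_mul]
    rfl
  simp only [hL]
  refine ⟨L.integrable_comp hint, ?_⟩
  rw [L.integral_comp_comm hint, hf, inner_operatorOfFunctional]
  rfl

theorem PhaseSpace.isProjectiveRep_timeFreqShift (d : ℕ) :
    IsProjectiveRep (PhaseSpace.timeFreqShift : PhaseSpace.Phase d → _) where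
  comp z w := ⟨_, PhaseSpace.norm_character w.2 (-z.1), PhaseSpace.timeFreqShift_comp z w⟩
  map_zero := PhaseSpace.timeFreqShift_zero
  norm_le := PhaseSpace.opNorm_timeFreqShift_le
  continuous := PhaseSpace.continuous_timeFreqShift

theorem proposition3p4 (d : ℕ) (S : PhaseSpace.L2 d →L[ℂ] PhaseSpace.L2 d)
    (hS : PhaseSpace.IsTraceClass S) :
    ∃ σ : PhaseSpace.L2 d →L[ℂ] PhaseSpace.L2 d, PhaseSpace.IsTraceClass σ ∧
      ∃ f : PhaseSpace.Phase d → ℂ, Integrable f volume ∧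
        PhaseSpace.IsGlauberSudarshan σ S f := by
  have : (volume : Measure (PhaseSpace.Phase d)).IsAddHaarMeasure :=
    inferInstanceAs ((volume.prod volume : Measure (PhaseSpace.Phase d)).IsAddHaarMeasure)
  exact (PhaseSpace.isProjectiveRep_timeFreqShift d).exists_isWeakIntegral volume hS
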